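/- A path-matching is a vertex-disjoint union of paths, each with at least two vertices; its order is the number of vertices it spans. Given positive integers $r,p_1,\dots,p_r$, let $R^{PM}(p_1,\dots,p_r)$ be the smallest integer $n$ such that in every $r$-coloring of the edges of the complete graph $K_n$ (that is, every assignment of one of the colors $1,\dots,r$ to each edge) there is, for some $i\in\{1,\dots,r\}$, a path-matching of order at least $p_i$ all of whose edges have color $i$. (i) For all integers $p_1\ge p_2\ge 2$, $$R^{PM}(p_1,p_2)=p_1+\left\lceil\frac{p_2}{3}\right\rceil-1.$$ (ii) For all integers $p_1\ge p_2\ge p_3\ge 2$ with $(p_1,p_2,p_3)\ne(3,3,3)$, $$R^{PM}(p_1,p_2,p_3)=p_1+\left\lceil\frac{p_2}{3}\right\rceil+\left\lceil\frac{p_3}{3}\right\rceil-2.$$ Furthermore, $R^{PM}(3,3,3)=4$. (iii) For all integers $p_1\ge p_2\ge p_3\ge p_4\ge 2$ with $(p_1,p_2,p_3,p_4)\notin\{(3,3,3,2),(3,3,3,3),(4,3,3,3)\}$, $$R^{PM}(p_1,p_2,p_3,p_4)=p_1+\left\lceil\frac{p_2}{3}\right\rceil+\left\lceil\frac{p_3}{3}\right\rceil+\left\lceil\frac{p_4}{3}\right\rceil-3.$$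 Furthermore, $R^{PM}(3,3,3,2)=R^{PM}(3,3,3,3)=4$ and $R^{PM}(4,3,3,3)=5$. -/

import Mathlib

namespace PathMatchingRamsey

/-- A path-matching in the graph `G`: finitely many pairwise vertex-disjoint paths of `G`,
each of them nontrivial, i.e. with at least one edge (equivalently, at least two vertices). -/
structure PathMatching {V : Type*} (G : SimpleGraph V) where
  /-- the number of paths -/
  numPaths : ℕ
  /-- the first vertex of each path -/
  start : Fin numPaths → V
  /-- the last vertex of each path -/
  finish : Fin numPaths → V
  /-- the paths, as walks of `G` -/
  path : ∀ i, G.Walk (start i) (finish i)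
  isPath : ∀ i, (path i).IsPath
  nontrivial : ∀ i, 1 ≤ (path i).length
  disjoint : ∀ i j, i ≠ j → (path i).support.Disjoint (path j).support

/-- The set of vertices spanned by a path-matching. -/
def PathMatching.verts {V : Type*} {G : SimpleGraph V} (P : PathMatching G) : Set V :=
  {v | ∃ i, v ∈ (P.path i).support}

/-- The order of a path-matching is the number of vertices that it spans. -/
noncomputable def PathMatching.order {V : Type*} {G : SimpleGraph V} (P : PathMatching G) : ℕ :=
  P.verts.ncard

/-- `Forces p n`: in every colouring of the edges of the complete graph `K_n` with `r` colours
(adjacent edges may get the same colour, and not every colour has to be used) there is, for some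
colour `i`, a path-matching of order at least `p i` all of whose edges have colour `i`. -/
def Forces {r : ℕ} (p : Fin r → ℕ) (n : ℕ) : Prop :=
  ∀ C : SimpleGraph.TopEdgeLabeling (Fin n) (Fin r),
    ∃ i : Fin r, ∃ P : PathMatching (C.labelGraph i), p i ≤ P.order

/-- `IsRPM p N` says that the Ramsey number `R^{PM}(p_1, …, p_r)` of path-matchings exists and
equals `N`: `N` is the smallest `n` such that every `r`-colouring of the edges of `K_n` contains
a path-matching of colour `i` and order at least `p_i` for some `i`. -/
def IsRPM {r : ℕ} (p : Fin r → ℕ) (N : ℕ) : Prop :=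
  IsLeast {n : ℕ | Forces p n} N

end PathMatchingRamsey

/-! Everything rests on a duality: the largest order of a path-matching in a finite graph is the
minimum of `#B + 3 * #S` over pairs such that every edge lies inside `B` or meets `S`
(`PathMatching.order_le`, `exists_coverable_isEdgeCoverOn`). Paths with two or three vertices
suffice, since longer ones can be cut up.

Upper bounds: in a colouring without the desired path-matchings, duality gives each colour a pair `B
i`, `S i` with `#(B i) + 3 * #(S i) < p i`. Off all the `S i` remains a set `R`, any two vertices of
which share some `B i`. If one `B i` fills `R`, or `#R ≤ 1`, the formula follows by arithmetic.
Otherwise every vertex of `R` lies in two of the `B i`, so `2 * #R ≤ ∑ i, #(B i)`, which settles two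
and three colours. For four colours the index sets of the vertices form an intersecting family,
which resembles a star or a triangle (`card_le_of_cover_four`).

Lower bounds: one class of `p₁ - 1` vertices and classes of `⌈pᵢ / 3⌉ - 1` vertices for the other
colours, an edge taking the larger class index of its ends; the exceptions come from explicit
colourings of `K_3` and `K_4`. -/

namespace PathMatchingRamsey

open Finset

/-! ### Weak duality: a cover bounds the order of every path-matching. -/

section WeakDuality

variable {V : Type*} {G : SimpleGraph V}

/-- Every edge of `G` lies inside `B` or meets `S`. -/
def IsEdgeCover (G : SimpleGraph V) (B S : Finset V) : Prop :=
  ∀ u v, G.Adj u v → (u ∈ B ∧ v ∈ B) ∨ u ∈ S ∨ v ∈ S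

variable [DecidableEq V] {B S : Finset V}

/-- Along a walk, the predecessor of a vertex outside `B` and `S` lies in `S`. Only the first vertex
has no predecessor, hence the correction term. -/
theorem IsEdgeCover.countP_support_le (h : IsEdgeCover G B S) {u v : V} (w : G.Walk u v) :
    w.support.countP (fun x => x ∉ B ∧ x ∉ S) ≤
      w.support.countP (fun x => x ∈ S) + if u ∉ B ∧ u ∉ S then 1 else 0 := by
  induction w with
  | @nil a => by_cases hB : a ∈ B <;> by_cases hS : a ∈ S <;> simp [hB, hS]
  | @cons a b c hab w ih =>
    have := h a b hab
    simp only [SimpleGraph.Walk.support_cons, List.countP_cons]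
    by_cases h1 : a ∈ B <;> by_cases h2 : a ∈ S <;> by_cases h3 : b ∈ B <;>
      by_cases h4 : b ∈ S <;> simp_all <;> omega

theorem IsEdgeCover.countP_support_le_two_mul (h : IsEdgeCover G B S) {u v : V} (w : G.Walk u v)
    (hw : 1 ≤ w.length) :
    w.support.countP (fun x => x ∉ B ∧ x ∉ S) ≤ 2 * w.support.countP (fun x => x ∈ S) := by
  have h1 := h.countP_support_le w
  split_ifs at h1 with hu
  -- A walk that starts outside `B` and `S` has its second vertex in `S`, so the extra 1 is absorbed
  -- by the factor 2.
  · cases w with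
    | nil => simp at hw
    | @cons _ b _ hab w =>
      have hb : b ∈ S := by
        have := h _ _ hab
        tauto
      have : 0 < (SimpleGraph.Walk.cons hab w).support.countP (fun x => x ∈ S) := by
        rw [List.countP_pos_iff]
        exact ⟨b, by simp, by simpa using hb⟩
      omega
  · omega

theorem IsEdgeCover.card_support_le (h : IsEdgeCover G B S) {u v : V} (w : G.Walk u v)
    (hp : w.IsPath) (hw : 1 ≤ w.length) :
    #w.support.toFinset ≤ #(w.support.toFinset ∩ B) + 3 * #(w.support.toFinset ∩ S) := by
  have key (p : V → Prop) [DecidablePred p] :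
      w.support.countP (fun x => p x) = #(w.support.toFinset.filter p) := by
    rw [List.countP_eq_length_filter, ← List.toFinset_card_of_nodup (hp.support_nodup.filter _)]
    congr 1
    ext x
    simp
  have h1 := h.countP_support_le_two_mul w hw
  rw [key, key] at h1
  have h2 : w.support.toFinset ⊆ (w.support.toFinset ∩ B) ∪ (w.support.toFinset ∩ S) ∪
      w.support.toFinset.filter (fun x => x ∉ B ∧ x ∉ S) := by
    intro x hx
    simp only [mem_union, mem_inter, mem_filter]
    tauto
  have h3 := card_le_card h2
  have h4 := card_union_le ((w.support.toFinset ∩ B) ∪ (w.support.toFinset ∩ S))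
    (w.support.toFinset.filter (fun x => x ∉ B ∧ x ∉ S))
  have h5 := card_union_le (w.support.toFinset ∩ B) (w.support.toFinset ∩ S)
  rw [filter_mem_eq_inter] at h1
  omega

theorem PathMatching.order_le (P : PathMatching G) (h : IsEdgeCover G B S) :
    P.order ≤ #B + 3 * #S := by
  have hd : ∀ i j, i ≠ j →
      Disjoint (P.path i).support.toFinset (P.path j).support.toFinset := by
    intro i j hij
    rw [List.disjoint_toFinset_iff_disjoint]
    exact P.disjoint i j hij
  have hsum (T : Finset V) : ∑ i, #((P.path i).support.toFinset ∩ T) ≤ #T := by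
    rw [← card_biUnion]
    · exact card_le_card (biUnion_subset.2 fun _ _ => inter_subset_right)
    · intro i _ j _ hij
      exact (hd i j hij).mono inter_subset_left inter_subset_left
  have hv : P.verts = ↑(univ.biUnion fun i => (P.path i).support.toFinset) := by
    ext v
    simp [PathMatching.verts]
  rw [PathMatching.order, hv, Set.ncard_coe_finset]
  calc _ ≤ ∑ i, #(P.path i).support.toFinset := card_biUnion_le
    _ ≤ ∑ i, (#((P.path i).support.toFinset ∩ B) + 3 * #((P.path i).support.toFinset ∩ S)) :=
      sum_le_sum fun i _ => h.card_support_le _ (P.isPath i) (P.nontrivial i)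
    _ = ∑ i, #((P.path i).support.toFinset ∩ B) +
        3 * ∑ i, #((P.path i).support.toFinset ∩ S) := by rw [sum_add_distrib, mul_sum]
    _ ≤ _ := by
      have := hsum B
      have := hsum S
      omega

end WeakDuality

/-! ### Path-matchings built from edges and cherries. -/

section Coverable

variable {V : Type*} {G : SimpleGraph V}

/-- The path-matching obtained from `P` by adding a path disjoint from it. -/
def PathMatching.cons (P : PathMatching G) {a b : V} (w : G.Walk a b) (hp : w.IsPath)
    (hw : 1 ≤ w.length) (hd : ∀ v ∈ w.support, v ∉ P.verts) : PathMatching G where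
  numPaths := P.numPaths + 1
  start := Fin.cons a P.start
  finish := Fin.cons b P.finish
  path := Fin.cases w P.path
  isPath := Fin.cases hp P.isPath
  nontrivial := Fin.cases hw P.nontrivial
  disjoint := by
    have h0 : ∀ j, w.support.Disjoint (P.path j).support :=
      fun j v hv hv' => hd v hv ⟨j, hv'⟩
    refine Fin.cases (Fin.cases (fun h => absurd rfl h) fun j _ => h0 j) fun i => ?_
    exact Fin.cases (fun _ => (h0 i).symm) fun j hij => P.disjoint i j fun h => hij (by rw [h])

theorem PathMatching.exists_verts_eq_union (P : PathMatching G) {a b : V} (w : G.Walk a b)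
    (hp : w.IsPath) (hw : 1 ≤ w.length) (hd : ∀ v ∈ w.support, v ∉ P.verts) :
    ∃ Q : PathMatching G, Q.verts = {v | v ∈ w.support} ∪ P.verts := by
  refine ⟨P.cons w hp hw hd, ?_⟩
  ext v
  exact Fin.exists_fin_succ

variable [DecidableEq V]

/-- `Coverable G W`: the set `W` is partitioned by paths of `G` with two or three vertices. -/
inductive Coverable (G : SimpleGraph V) : Finset V → Prop
  | empty : Coverable G ∅
  | edge {W : Finset V} {a b : V} (hW : Coverable G W) (hab : G.Adj a b) (ha : a ∉ W)
      (hb : b ∉ W) : Coverable G (insert a (insert b W))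
  | cherry {W : Finset V} {a b c : V} (hW : Coverable G W) (hab : G.Adj a b) (hac : G.Adj a c)
      (hbc : b ≠ c) (ha : a ∉ W) (hb : b ∉ W) (hc : c ∉ W) :
      Coverable G (insert a (insert b (insert c W)))

theorem Coverable.mono {G' : SimpleGraph V} (hG : G ≤ G') {W : Finset V} (h : Coverable G W) :
    Coverable G' W := by
  induction h with
  | empty => exact .empty
  | edge _ hab ha hb ih => exact ih.edge (hG hab) ha hb
  | cherry _ hab hac hbc ha hb hc ih => exact ih.cherry (hG hab) (hG hac) hbc ha hb hc

theorem Coverable.union {W W' : Finset V} (h : Coverable G W) (h' : Coverable G W')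
    (hd : Disjoint W W') : Coverable G (W ∪ W') := by
  induction h with
  | empty => simpa using h'
  | edge _ hab ha hb ih =>
    simp only [disjoint_insert_left] at hd
    rw [insert_union, insert_union]
    exact (ih hd.2.2).edge hab (by simp [ha, hd.1]) (by simp [hb, hd.2.1])
  | cherry _ hab hac hbc ha hb hc ih =>
    simp only [disjoint_insert_left] at hd
    rw [insert_union, insert_union, insert_union]
    exact (ih hd.2.2.2).cherry hab hac hbc (by simp [ha, hd.1]) (by simp [hb, hd.2.1])
      (by simp [hc, hd.2.2.1])

theorem Coverable.exists_pathMatching {W : Finset V} (h : Coverable G W) :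
    ∃ P : PathMatching G, P.verts = ↑W := by
  induction h with
  | empty =>
    exact ⟨⟨0, Fin.elim0, Fin.elim0, fun i => i.elim0, fun i => i.elim0, fun i => i.elim0,
      fun i => i.elim0⟩, by ext v; simp [PathMatching.verts]⟩
  | @edge W a b _ hab ha hb ih =>
    obtain ⟨P, hP⟩ := ih
    obtain ⟨Q, hQ⟩ := P.exists_verts_eq_union (.cons hab .nil)
      (by rw [SimpleGraph.Walk.cons_isPath_iff]; simp [hab.ne]) (by simp) (by simp [hP, ha, hb])
    refine ⟨Q, hQ.trans ?_⟩
    ext v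
    simp [hP, or_assoc]
  | @cherry W a b c _ hab hac hbc ha hb hc ih =>
    obtain ⟨P, hP⟩ := ih
    obtain ⟨Q, hQ⟩ := P.exists_verts_eq_union (.cons hab.symm (.cons hac .nil))
      (by simp [SimpleGraph.Walk.cons_isPath_iff, hab.ne', hac.ne, hbc]) (by simp)
      (by simp [hP, ha, hb, hc])
    refine ⟨Q, hQ.trans ?_⟩
    ext v
    simp [hP]
    tauto

end Coverable

end PathMatchingRamsey

namespace PathMatchingRamsey

open Finset

/-! ### Strong duality: Hall's theorem and deletion of an edge. -/

section StrongDuality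

open scoped Classical

variable {V : Type*} [DecidableEq V] {G : SimpleGraph V} {X B S : Finset V}

/-- The vertices of `X \ S` all of whose neighbours in `X` lie in `S`. -/
noncomputable def isolatedIn (G : SimpleGraph V) (X S : Finset V) : Finset V :=
  {v ∈ X \ S | ∀ w ∈ X, G.Adj v w → w ∈ S}

theorem mem_isolatedIn {v : V} :
    v ∈ isolatedIn G X S ↔ (v ∈ X ∧ v ∉ S) ∧ ∀ w ∈ X, G.Adj v w → w ∈ S := by
  simp [isolatedIn]

/-- Every edge of `G` inside `X` lies inside `B` or meets `S`. -/
def IsEdgeCoverOn (G : SimpleGraph V) (X B S : Finset V) : Prop :=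
  ∀ u ∈ X, ∀ v ∈ X, G.Adj u v → (u ∈ B ∧ v ∈ B) ∨ u ∈ S ∨ v ∈ S

/-- A vertex outside `B` and `S` has all its neighbours in `S`, so it is isolated once `S` is
removed. -/
theorem IsEdgeCoverOn.card_le (h : IsEdgeCoverOn G X B S) :
    #X ≤ #B + #S + #(isolatedIn G X S) := by
  have : X ⊆ B ∪ S ∪ isolatedIn G X S := by
    intro v hv
    simp only [mem_union, mem_isolatedIn]
    by_contra! hc
    obtain ⟨⟨hB, hS⟩, hI⟩ := hc
    obtain ⟨w, hw, hvw, hwS⟩ := hI ⟨hv, hS⟩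
    have := h v hv w hw hvw
    tauto
  have h1 := card_le_card this
  have h2 := card_union_le (B ∪ S) (isolatedIn G X S)
  have h3 := card_union_le B S
  omega

theorem Coverable.biUnion {s : Finset V} {f : V → Finset V} (h : ∀ v ∈ s, Coverable G (f v))
    (hd : (s : Set V).PairwiseDisjoint f) : Coverable G (s.biUnion f) := by
  induction s using Finset.induction_on with
  | empty => exact .empty
  | insert a s ha ih =>
    rw [biUnion_insert]
    refine (h a (mem_insert_self a s)).union
      (ih (fun v hv => h v (mem_insert_of_mem hv)) (hd.subset (by simp))) ?_
    rw [disjoint_biUnion_right]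
    intro v hv
    exact hd (by simp) (by simp [hv]) fun hav => ha (hav ▸ hv)

/-- Hall's theorem for slots: `(s, false)` and `(s, true)` are the two possible leaves at `s`. A
violation of Hall's condition would make the part of `S` outside the violating set contradict the
minimality of `S`. -/
theorem exists_injOn_isolatedIn {t : ℕ} {J : Finset (V × Bool)}
    (hJS : J ⊆ S ×ˢ univ) (hJ : #J + t = 2 * #S) (hI : 2 * #S ≤ #(isolatedIn G X S) + t)
    (hmin : ∀ T, T ⊂ S → T.Nonempty → #(isolatedIn G X T) + t < 2 * #T)
    (hiso : ∀ x ∈ X, ∃ y ∈ X, G.Adj x y) :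
    ∃ g : V × Bool → V, Set.InjOn g J ∧ ∀ j ∈ J, g j ∈ isolatedIn G X S ∧ G.Adj j.1 (g j) := by
  obtain ⟨f, hf, hfI⟩ := (all_card_le_biUnion_card_iff_exists_injective
    fun j : J => {v ∈ isolatedIn G X S | G.Adj j.1.1 v}).1 (by
      intro Y
      set Z : Finset V := Y.image fun j => j.1.1 with hZ
      set N := Y.biUnion fun j : J => {v ∈ isolatedIn G X S | G.Adj j.1.1 v} with hN
      have hZS : Z ⊆ S := by
        intro v hv
        obtain ⟨j, -, rfl⟩ := mem_image.1 hv
        exact (mem_product.1 (hJS j.2)).1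
      have hYJ : #Y ≤ #J := by
        simpa using card_le_univ Y
      -- When all of `S` is hit, every isolated vertex is reached, since by `hiso` it has a
      -- neighbour, necessarily in `S`.
      by_cases hZeq : Z = S
      · have : isolatedIn G X S ⊆ N := by
          intro v hv
          have hv' := mem_isolatedIn.1 hv
          obtain ⟨w, hw, hvw⟩ := hiso v hv'.1.1
          have hwZ : w ∈ Z := hZeq ▸ hv'.2 w hw hvw
          obtain ⟨j, hj, rfl⟩ := mem_image.1 hwZ
          exact mem_biUnion.2 ⟨j, hj, by simp [hv, hvw.symm]⟩
        have := card_le_card this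
        omega
      · have hYZ : #Y ≤ 2 * #Z := by
          have : Y.map (Function.Embedding.subtype _) ⊆ Z ×ˢ (univ : Finset Bool) := by
            intro p hp
            obtain ⟨j, hj, rfl⟩ := mem_map.1 hp
            exact mem_product.2 ⟨mem_image_of_mem _ hj, mem_univ _⟩
          have := card_le_card this
          rw [card_map, card_product] at this
          simp at this
          omega
        -- Isolated vertices not reached from `Z` stay isolated when only `S \ Z` is removed;
        -- minimality then leaves more than `2 * #Z` vertices in `N`.
        have hsub : isolatedIn G X S \ N ⊆ isolatedIn G X (S \ Z) := by
          intro v hv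
          obtain ⟨hv, hvN⟩ := mem_sdiff.1 hv
          have hv' := mem_isolatedIn.1 hv
          refine mem_isolatedIn.2 ⟨⟨hv'.1.1, fun h => hv'.1.2 (mem_sdiff.1 h).1⟩, ?_⟩
          intro w hw hvw
          refine mem_sdiff.2 ⟨hv'.2 w hw hvw, fun hwZ => hvN ?_⟩
          obtain ⟨j, hj, rfl⟩ := mem_image.1 hwZ
          exact mem_biUnion.2 ⟨j, hj, by simp [hv, hvw.symm]⟩
        have h1 := card_le_card hsub
        have h2 := le_card_sdiff N (isolatedIn G X S)
        have h3 := card_sdiff_add_card_eq_card hZS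
        rcases Y.eq_empty_or_nonempty with rfl | hY
        · simp
        have hZne : Z.Nonempty := hY.image _
        have h4 := hmin (S \ Z) (sdiff_ssubset hZS hZne)
          (sdiff_nonempty.2 fun h => hZeq (hZS.antisymm h))
        omega)
  refine ⟨fun p => if h : p ∈ J then f ⟨p, h⟩ else p.1, ?_, ?_⟩
  · intro p hp q hq hpq
    simp only [mem_coe] at hp hq
    simp only [hp, hq, dif_pos] at hpq
    simpa using hf hpq
  · intro j hj
    have := hfI ⟨j, hj⟩
    simpa [hj] using this

/-- The slots become cherries centred at the vertices of `S`; for `t = 1` one of the cherries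
shrinks to an edge. -/
theorem exists_coverable_of_minimal {t : ℕ} (ht : t ≤ 1) (hSne : S.Nonempty)
    (hI : 2 * #S ≤ #(isolatedIn G X S) + t)
    (hmin : ∀ T, T ⊂ S → T.Nonempty → #(isolatedIn G X T) + t < 2 * #T)
    (hiso : ∀ x ∈ X, ∃ y ∈ X, G.Adj x y) :
    ∃ C ⊆ S ∪ isolatedIn G X S, Coverable G C ∧ 3 * #S ≤ #C + t := by
  obtain ⟨J, hJS, hJ, hJf⟩ : ∃ J : Finset (V × Bool), J ⊆ S ×ˢ univ ∧ #J + t = 2 * #S ∧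
      ∀ s ∈ S, (s, false) ∈ J := by
    have hcard : #(S ×ˢ (univ : Finset Bool)) = 2 * #S := by
      rw [card_product]; simp [mul_comm]
    obtain rfl | rfl : t = 0 ∨ t = 1 := by omega
    · exact ⟨S ×ˢ univ, Subset.rfl, hcard, by simp⟩
    · obtain ⟨s, hs⟩ := hSne
      refine ⟨(S ×ˢ univ).erase (s, true), erase_subset _ _, ?_, by simp⟩
      rw [card_erase_add_one (by simp [hs]), hcard]
  obtain ⟨g, hg, hgI⟩ := exists_injOn_isolatedIn hJS hJ hI hmin hiso
  have hgS : ∀ j ∈ J, g j ∉ S := fun j hj => (mem_isolatedIn.1 (hgI j hj).1).1.2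
  have hJ1 : ∀ j ∈ J, j.1 ∈ S := fun j hj => (mem_product.1 (hJS hj)).1
  refine ⟨S ∪ J.image g, ?_, ?_, ?_⟩
  · exact union_subset_union_right (image_subset_iff.2 fun j hj => (hgI j hj).1)
  · have heq : S ∪ J.image g =
        S.biUnion fun s => insert s ({j ∈ J | j.1 = s}.image g) := by
      ext v
      simp only [mem_union, mem_image, mem_biUnion, mem_insert, mem_filter]
      constructor
      · rintro (hv | ⟨j, hj, rfl⟩)
        · exact ⟨v, hv, .inl rfl⟩
        · exact ⟨j.1, hJ1 j hj, .inr ⟨j, ⟨hj, rfl⟩, rfl⟩⟩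
      · rintro ⟨s, hs, rfl | ⟨j, ⟨hj, rfl⟩, rfl⟩⟩
        · exact .inl hs
        · exact .inr ⟨j, hj, rfl⟩
    rw [heq]
    apply Coverable.biUnion
    · intro s hs
      have h0 := hJf s hs
      by_cases h1 : (s, true) ∈ J
      · have : ({j ∈ J | j.1 = s} : Finset (V × Bool)) = {(s, false), (s, true)} := by
          ext ⟨a, b⟩
          cases b <;> simp <;> rintro rfl <;> assumption
        rw [this, image_insert, image_singleton]
        exact Coverable.empty.cherry (hgI _ h0).2 (hgI _ h1).2
          (fun h => by simpa using hg h0 h1 h) (by simp) (by simp) (by simp)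
      · have : ({j ∈ J | j.1 = s} : Finset (V × Bool)) = {(s, false)} := by
          ext ⟨a, b⟩
          cases b
          · simp; rintro rfl; assumption
          · simp; rintro h rfl; exact h1 h
        rw [this, image_singleton]
        exact Coverable.empty.edge (hgI _ h0).2 (by simp) (by simp)
    · intro s hs s' hs' hne
      simp only [Function.onFun]
      rw [disjoint_left]
      intro v hv hv'
      simp only [mem_insert, mem_image, mem_filter] at hv hv'
      rcases hv with rfl | ⟨j, ⟨hj, rfl⟩, rfl⟩
      · rcases hv' with rfl | ⟨j', ⟨hj', rfl⟩, h⟩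
        · exact hne rfl
        · exact hgS j' hj' (h ▸ hs)
      · rcases hv' with h | ⟨j', ⟨hj', rfl⟩, h⟩
        · exact hgS j hj (h ▸ hs')
        · exact hne (congrArg Prod.fst (hg hj' hj h)).symm
  · rw [card_union_of_disjoint, card_image_of_injOn hg]
    · omega
    · rw [disjoint_right]
      intro v hv
      obtain ⟨j, hj, rfl⟩ := mem_image.1 hv
      exact hgS j hj

theorem IsEdgeCoverOn.union {S' B' : Finset V}
    (h : IsEdgeCoverOn G (X \ (S ∪ isolatedIn G X S)) B' S') :
    IsEdgeCoverOn G X B' (S ∪ S') := by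
  intro u hu v hv huv
  simp only [mem_union]
  by_cases huS : u ∈ S
  · tauto
  by_cases hvS : v ∈ S
  · tauto
  have h1 : u ∉ isolatedIn G X S := fun h => hvS ((mem_isolatedIn.1 h).2 v hv huv)
  have h2 : v ∉ isolatedIn G X S := fun h => huS ((mem_isolatedIn.1 h).2 u hu huv.symm)
  have := h u (by simp [*]) v (by simp [*]) huv
  tauto

/-- Deleting one edge creates at most two new isolated vertices, exactly the slack in `hlt`. So a
cover of the smaller graph still has value at least `#X`, and `W` must be everything. -/
theorem exists_coverable_of_forall_card_isolatedIn_lt [Finite V] {x y : V} {W : Finset V}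
    (hiso : ∀ x ∈ X, ∃ y ∈ X, G.Adj x y)
    (hlt : ∀ T ⊆ X, T.Nonempty → #(isolatedIn G X T) + 2 ≤ 2 * #T) (hS : S ⊆ X)
    (h : IsEdgeCoverOn (G.deleteEdges {s(x, y)}) X B S) (hW : #B + 3 * #S ≤ #W) : #X ≤ #W := by
  rcases S.eq_empty_or_nonempty with rfl | hSne
  · refine le_trans (card_le_card fun u hu => ?_) ((Nat.le_add_right _ _).trans hW)
    obtain ⟨v, hv, huv⟩ := hiso u hu
    by_contra huB
    have hn : ∀ w ∈ X, G.Adj u w → s(u, w) = s(x, y) := by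
      intro w hw huw
      by_contra hne
      have := h u hu w hw (by simp [SimpleGraph.deleteEdges_adj, huw, hne])
      simp [huB] at this
    -- Here the deleted edge is the only one at `u`, so `u` hangs on `v` alone, which `hlt` forbids
    -- for `{v}`.
    have : u ∈ isolatedIn G X {v} := by
      refine mem_isolatedIn.2 ⟨⟨hu, by simpa using huv.ne⟩, fun w hw huw => ?_⟩
      simpa using Sym2.congr_right.1 ((hn w hw huw).trans (hn v hv huv).symm)
    have h1 := hlt {v} (by simpa using hv) (by simp)
    have h2 := card_pos.2 ⟨u, this⟩
    simp at h1
    simp [h1] at this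
  · have h1 := h.card_le
    have h2 : isolatedIn (G.deleteEdges {s(x, y)}) X S ⊆ isolatedIn G X S ∪ {x, y} := by
      intro v hv
      obtain ⟨hv, hvS⟩ := mem_isolatedIn.1 hv
      by_cases hvxy : v = x ∨ v = y
      · exact mem_union_right _ (by simpa using hvxy)
      · refine mem_union_left _ (mem_isolatedIn.2 ⟨hv, fun w hw hvw => hvS w hw ?_⟩)
        simp only [SimpleGraph.deleteEdges_adj, hvw, true_and, Set.mem_singleton_iff, Sym2.eq_iff]
        tauto
    have h3 := card_le_card h2
    have h4 := card_union_le (isolatedIn G X S) {x, y}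
    have h5 : #({x, y} : Finset V) ≤ 2 := card_le_two
    have h6 := hlt S hS hSne
    omega

theorem exists_minimal_isolatedIn {t : ℕ}
    (h : ∃ T ⊆ X, T.Nonempty ∧ 2 * #T ≤ #(isolatedIn G X T) + t) :
    ∃ S ⊆ X, S.Nonempty ∧ 2 * #S ≤ #(isolatedIn G X S) + t ∧
      ∀ T, T ⊂ S → T.Nonempty → #(isolatedIn G X T) + t < 2 * #T := by
  obtain ⟨T, hTX, hT, hTc⟩ := h
  obtain ⟨S, hS, hmin⟩ := exists_min_image
    {T ∈ X.powerset | T.Nonempty ∧ 2 * #T ≤ #(isolatedIn G X T) + t} card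
    ⟨T, by simp [hTX, hT, hTc]⟩
  simp only [mem_filter, mem_powerset] at hS hmin
  refine ⟨S, hS.1, hS.2.1, hS.2.2, fun T hTS hT => ?_⟩
  by_contra! hc
  have := hmin T ⟨hTS.subset.trans hS.1, hT, hc⟩
  have := card_lt_card hTS
  omega

/-- The maximum number of vertices of `X` that can be partitioned by nontrivial paths is the
minimum of `#B + 3 * #S` over all `B` and `S` such that every edge lies inside `B` or meets `S`. -/
theorem exists_coverable_isEdgeCoverOn [Finite V] (G : SimpleGraph V) (X : Finset V) :
    ∃ W ⊆ X, Coverable G W ∧ ∃ B S, S ⊆ X ∧ IsEdgeCoverOn G X B S ∧ #B + 3 * #S ≤ #W := by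
  -- The measure drops both when vertices leave `X` and when an edge of `G` is deleted.
  induction hn : #X + G.edgeSet.ncard using Nat.strong_induction_on generalizing G X with
  | _ n ih =>
  have ihX (Y : Finset V) (hY : #Y < #X) := ih (#Y + G.edgeSet.ncard) (by omega) G Y rfl
  have hperf (h : Coverable G X) :
      ∃ W ⊆ X, Coverable G W ∧ ∃ B S, S ⊆ X ∧ IsEdgeCoverOn G X B S ∧ #B + 3 * #S ≤ #W :=
    ⟨X, Subset.rfl, h, X, ∅, by simp, fun u hu v hv _ => .inl ⟨hu, hv⟩, by simp⟩
  by_cases hiso : ∀ x ∈ X, ∃ y ∈ X, G.Adj x y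
  swap
  · push Not at hiso
    obtain ⟨x, hx, hxX⟩ := hiso
    obtain ⟨W, hWX, hW, B, S, hSX, hBS, hc⟩ := ihX (X.erase x) (card_erase_lt_of_mem hx)
    refine ⟨W, hWX.trans (erase_subset _ _), hW, B, S, hSX.trans (erase_subset _ _), ?_, hc⟩
    intro u hu v hv huv
    refine hBS u (mem_erase.2 ⟨?_, hu⟩) v (mem_erase.2 ⟨?_, hv⟩) huv
    · rintro rfl
      exact hxX v hv huv
    · rintro rfl
      exact hxX u hu huv.symm
  -- Induction on what is left after removing `S` and its isolated vertices, glued to a partial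
  -- covering `C` of the removed part.
  have extend {S C : Finset V} (hS : S ⊆ X) (hSne : S.Nonempty)
      (hC : C ⊆ S ∪ isolatedIn G X S) (hCc : Coverable G C) :
      ∃ W ⊆ X, Coverable G W ∧ ∃ B S', S' ⊆ X ∧ Disjoint S S' ∧ IsEdgeCoverOn G X B (S ∪ S') ∧
        (S' = ∅ → X \ (S ∪ isolatedIn G X S) ⊆ B) ∧ #B + 3 * #S' + #C ≤ #W := by
    have hI : S ∪ isolatedIn G X S ⊆ X :=
      union_subset hS fun v hv => (mem_isolatedIn.1 hv).1.1
    obtain ⟨W, hWX, hW, B, S', hSX, hBS, hc⟩ := ihX (X \ (S ∪ isolatedIn G X S))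
      (card_lt_card (sdiff_ssubset hI (hSne.mono subset_union_left)))
    have hd : Disjoint W C := (disjoint_sdiff_self_left.mono_left hWX).mono_right hC
    refine ⟨W ∪ C, union_subset (hWX.trans sdiff_subset) (hC.trans hI), hW.union hCc hd, B, S',
      hSX.trans sdiff_subset, ?_, hBS.union, ?_, ?_⟩
    · exact (disjoint_sdiff_self_right.mono_right hSX).mono_left subset_union_left
    · rintro rfl u hu
      have hu' := mem_sdiff.1 hu
      have : ∃ w ∈ X, G.Adj u w ∧ w ∉ S := by
        by_contra! hcon
        simp only [mem_union, mem_isolatedIn] at hu'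
        tauto
      obtain ⟨w, hw, huw, hwS⟩ := this
      have huS : u ∉ S := fun h => hu'.2 (mem_union_left _ h)
      have hwI : w ∉ isolatedIn G X S := fun h =>
        huS ((mem_isolatedIn.1 h).2 u hu'.1 huw.symm)
      have := hBS u hu w (by simp [hw, hwS, hwI]) huw
      exact (this.resolve_right (by simp)).1
    · rw [card_union_of_disjoint hd]
      omega
  by_cases h0 : ∃ T ⊆ X, T.Nonempty ∧ 2 * #T ≤ #(isolatedIn G X T) + 0
  · obtain ⟨S, hS, hSne, hSc, hmin⟩ := exists_minimal_isolatedIn h0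
    obtain ⟨C, hC, hCc, hcard⟩ :=
      exists_coverable_of_minimal (Nat.zero_le 1) hSne hSc hmin hiso
    obtain ⟨W, hWX, hW, B, S', hS', -, hBS, -, hc⟩ := extend hS hSne hC hCc
    have := card_union_le S S'
    exact ⟨W, hWX, hW, B, S ∪ S', union_subset hS hS', hBS, by omega⟩
  push Not at h0
  by_cases h1 : ∃ T ⊆ X, T.Nonempty ∧ 2 * #T ≤ #(isolatedIn G X T) + 1
  · obtain ⟨S, hS, hSne, hSc, hmin⟩ := exists_minimal_isolatedIn h1
    obtain ⟨C, hC, hCc, hcard⟩ := exists_coverable_of_minimal le_rfl hSne hSc hmin hiso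
    obtain ⟨W, hWX, hW, B, S', hS', hd, hBS, hB, hc⟩ := extend hS hSne hC hCc
    -- `C` may fall one short of `3 * #S`, but `h0` gains one in the bound on isolated vertices, so
    -- the covering is perfect.
    have hWX' : #X ≤ #W := by
      rcases S'.eq_empty_or_nonempty with rfl | hS'ne
      · have h2 := card_le_card (hB rfl)
        have h3 := le_card_sdiff (S ∪ isolatedIn G X S) X
        have h4 := card_union_le S (isolatedIn G X S)
        have h5 := h0 S hS hSne
        omega
      · have h2 := hBS.card_le
        have h3 := h0 (S ∪ S') (union_subset hS hS') (hSne.mono subset_union_left)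
        have h4 := card_union_of_disjoint hd
        omega
    exact hperf (eq_of_subset_of_card_le hWX hWX' ▸ hW)
  push Not at h1
  rcases X.eq_empty_or_nonempty with rfl | ⟨x, hx⟩
  · exact hperf .empty
  obtain ⟨y, -, hxy⟩ := hiso x hx
  have hlt : (G.deleteEdges {s(x, y)}).edgeSet.ncard < G.edgeSet.ncard := by
    rw [SimpleGraph.edgeSet_deleteEdges]
    exact Set.ncard_sdiff_singleton_lt_of_mem hxy (Set.toFinite _)
  obtain ⟨W, hWX, hW, B, S, hS, hBS, hc⟩ :=
    ih (#X + (G.deleteEdges {s(x, y)}).edgeSet.ncard) (by omega) (G.deleteEdges {s(x, y)}) X rfl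
  have := exists_coverable_of_forall_card_isolatedIn_lt hiso
    (fun T hT hTne => h1 T hT hTne) hS hBS hc
  exact hperf (eq_of_subset_of_card_le hWX this ▸ hW.mono (SimpleGraph.deleteEdges_le _))

/-- Duality for path-matchings in a finite graph. -/
theorem exists_pathMatching_isEdgeCover [Fintype V] (G : SimpleGraph V) :
    ∃ P : PathMatching G, ∃ B S, IsEdgeCover G B S ∧ #B + 3 * #S ≤ P.order := by
  obtain ⟨W, -, hW, B, S, -, hBS, hc⟩ := exists_coverable_isEdgeCoverOn G univ
  obtain ⟨P, hP⟩ := hW.exists_pathMatching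
  refine ⟨P, B, S, fun u v => hBS u (mem_univ u) v (mem_univ v), ?_⟩
  rwa [PathMatching.order, hP, Set.ncard_coe_finset]

end StrongDuality

end PathMatchingRamsey

namespace PathMatchingRamsey

open Finset SimpleGraph

/-! ### Lower bounds from colourings given with covers. -/

section Lower

theorem not_forces_of_isEdgeCover {r n : ℕ} {p : Fin r → ℕ} (f : Fin n → Fin n → Fin r)
    (hf : ∀ u v, f u v = f v u) (B S : Fin r → Finset (Fin n))
    (h : ∀ u v, u ≠ v → (u ∈ B (f u v) ∧ v ∈ B (f u v)) ∨ u ∈ S (f u v) ∨ v ∈ S (f u v))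
    (hc : ∀ i, #(B i) + 3 * #(S i) < p i) : ¬ Forces p n := by
  intro hF
  obtain ⟨i, P, hP⟩ := hF (EdgeLabeling.mk (fun u v _ => f u v) fun u v _ => hf v u)
  have hcov : IsEdgeCover ((EdgeLabeling.mk (G := (⊤ : SimpleGraph (Fin n)))
      (fun u v _ => f u v) fun u v _ => hf v u).labelGraph i) (B i) (S i) := by
    intro u v huv
    obtain ⟨hne, rfl⟩ := (TopEdgeLabeling.labelGraph_adj u v).1 huv
    rw [EdgeLabeling.get_mk]
    exact h u v hne
  have := P.order_le hcov
  have := hc i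
  omega

/-- Split the vertices into classes of sizes at most `q i` and colour an edge by the larger class.
Class 0 serves as `B` for colour 0, and class `i` as `S` for every other colour `i`. -/
theorem not_forces_of_le {r n : ℕ} {p : Fin (r + 1) → ℕ} (hp : ∀ i, 1 ≤ p i)
    (hn : n ≤ p 0 - 1 + ∑ i : Fin r, (p i.succ - 1) / 3) : ¬ Forces p n := by
  let q : Fin (r + 1) → ℕ := Fin.cons (p 0 - 1) fun i => (p i.succ - 1) / 3
  have hq : n ≤ Fintype.card (Σ i, Fin (q i)) := by
    simpa [Fin.sum_univ_succ, q] using hn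
  obtain ⟨e⟩ : Nonempty (Fin n ↪ Σ i, Fin (q i)) :=
    Function.Embedding.nonempty_of_card_le (by simpa using hq)
  let c : Fin n → Fin (r + 1) := fun v => (e v).1
  have hcard (i) : #{v | c v = i} ≤ q i := by
    have : (({v | c v = i} : Finset (Fin n)).map e) ⊆ univ.map (Function.Embedding.sigmaMk i) := by
      intro x hx
      obtain ⟨v, hv, rfl⟩ := mem_map.1 hx
      obtain rfl : (e v).1 = i := by simpa [c] using hv
      exact mem_map.2 ⟨(e v).2, mem_univ _, rfl⟩
    simpa using card_le_card this
  refine not_forces_of_isEdgeCover (fun u v => max (c u) (c v)) (fun u v => max_comm _ _)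
    (fun i => if i = 0 then univ.filter (c · = i) else ∅)
    (fun i => if i = 0 then ∅ else univ.filter (c · = i)) ?_ ?_
  · intro u v _
    by_cases h0 : max (c u) (c v) = 0
    · have : c u = 0 ∧ c v = 0 := by
        constructor <;> apply le_antisymm _ (Fin.zero_le _) <;> rw [← h0] <;> simp
      simp [this]
    · right
      rcases max_choice (c u) (c v) with h | h
      · left; simp only [if_neg h0]; simp [h]
      · right; simp only [if_neg h0]; simp [h]
  · intro i
    have h1 := hcard i
    have h2 := hp i
    refine Fin.cases (fun h1 h2 => ?_) (fun j h1 h2 => ?_) i h1 h2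
    · simp only [q, Fin.cons_zero] at h1
      simp only [if_true, card_empty]
      omega
    · simp only [q, Fin.cons_succ] at h1
      simp only [Fin.succ_ne_zero, if_false, card_empty]
      omega

end Lower

/-! ### Upper bounds: covering the pairs of a set by subsets. -/

section Upper

/-- Strong duality in each colour; `R` is the complement of the union of the sets `S i`, so an edge
inside `R` must lie in the `B i` of its colour. -/
theorem exists_cover_of_not_forces {r n : ℕ} {p : Fin r → ℕ} (h : ¬ Forces p n) :
    ∃ (R : Finset (Fin n)) (B : Fin r → Finset (Fin n)) (s : Fin r → ℕ),
      (∀ i, #(B i) + 3 * s i < p i) ∧ n ≤ #R + ∑ i, s i ∧ (∀ i, B i ⊆ R) ∧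
      ∀ u ∈ R, ∀ v ∈ R, u ≠ v → ∃ i, u ∈ B i ∧ v ∈ B i := by
  simp only [Forces, not_forall, not_exists, not_le] at h
  obtain ⟨C, hC⟩ := h
  choose P B S hBS hc using fun i => exists_pathMatching_isEdgeCover (C.labelGraph i)
  set R : Finset (Fin n) := (univ.biUnion S)ᶜ with hR
  refine ⟨R, fun i => B i ∩ R, fun i => #(S i), fun i => ?_, ?_, fun i => inter_subset_right, ?_⟩
  · beta_reduce
    have h1 := hC i (P i)
    have h2 := hc i
    have h3 : #(B i ∩ R) ≤ #(B i) := card_le_card inter_subset_left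
    omega
  · beta_reduce
    have h1 : #(univ.biUnion S) ≤ ∑ i, #(S i) := card_biUnion_le
    have h2 := card_add_card_compl (univ.biUnion S)
    rw [Fintype.card_fin, ← hR] at h2
    omega
  · intro u hu v hv huv
    have hmem {w : Fin n} (hw : w ∈ R) (i : Fin r) : w ∉ S i := by
      simp only [hR, mem_compl, mem_biUnion, mem_univ, true_and, not_exists] at hw
      exact hw i
    have := hBS (C.get u v huv) u v ((TopEdgeLabeling.labelGraph_adj u v).2 ⟨huv, rfl⟩)
    simp only [hmem hu, hmem hv, or_false] at this
    exact ⟨_, mem_inter.2 ⟨this.1, hu⟩, mem_inter.2 ⟨this.2, hv⟩⟩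

variable {V : Type*} {r : ℕ} {R : Finset V} {B : Fin r → Finset V}

theorem exists_ne_mem_of_cover (hcov : ∀ u ∈ R, ∀ v ∈ R, u ≠ v → ∃ i, u ∈ B i ∧ v ∈ B i)
    (hR : 1 < #R) (hB : ∀ i, #(B i) < #R) {v : V} (hv : v ∈ R) :
    ∃ i j, i ≠ j ∧ v ∈ B i ∧ v ∈ B j := by
  obtain ⟨w, hw, hwv⟩ := exists_mem_ne hR v
  obtain ⟨i, hi, -⟩ := hcov v hv w hw hwv.symm
  obtain ⟨x, hx, hxi⟩ := exists_mem_notMem_of_card_lt_card (hB i)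
  obtain ⟨j, hj, hxj⟩ := hcov v hv x hx fun h => hxi (h ▸ hi)
  exact ⟨i, j, fun h => hxi (h ▸ hxj), hi, hj⟩

variable [DecidableEq V]

/-- Weighted double counting of the pairs `v ∈ B i`. -/
theorem mul_card_le_sum_of_cover (hBR : ∀ i, B i ⊆ R) (c : Fin r → ℕ) (k : ℕ)
    (h : ∀ v ∈ R, k ≤ ∑ i with v ∈ B i, c i) : k * #R ≤ ∑ i, c i * #(B i) := by
  calc k * #R = ∑ v ∈ R, k := by simp [mul_comm]
    _ ≤ ∑ v ∈ R, ∑ i with v ∈ B i, c i := sum_le_sum h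
    _ = ∑ i, ∑ v ∈ B i, c i := by
      refine sum_comm' fun v i => ?_
      simp only [mem_filter, mem_univ, true_and, and_true]
      exact ⟨fun h => h.2, fun h => ⟨hBR i h, h⟩⟩
    _ = ∑ i, c i * #(B i) := by simp [mul_comm]

theorem two_le_card_filter_of_cover
    (hcov : ∀ u ∈ R, ∀ v ∈ R, u ≠ v → ∃ i, u ∈ B i ∧ v ∈ B i)
    (hR : 1 < #R) (hB : ∀ i, #(B i) < #R) {v : V} (hv : v ∈ R) :
    2 ≤ #{i | v ∈ B i} := by
  obtain ⟨i, j, hij, hi, hj⟩ := exists_ne_mem_of_cover hcov hR hB hv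
  exact one_lt_card.2 ⟨i, by simpa, j, by simpa, hij⟩

theorem two_mul_card_le_of_cover (hBR : ∀ i, B i ⊆ R)
    (hcov : ∀ u ∈ R, ∀ v ∈ R, u ≠ v → ∃ i, u ∈ B i ∧ v ∈ B i)
    (hR : 1 < #R) (hB : ∀ i, #(B i) < #R) : 2 * #R ≤ ∑ i, #(B i) := by
  simpa using mul_card_le_sum_of_cover hBR (fun _ => 1) 2 fun v hv => by
    simpa using two_le_card_filter_of_cover hcov hR hB hv

/-- Pairwise intersecting pairs in a four-element set, no element of which lies in all of them,
form a triangle. -/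
theorem exists_two_le_card_erase : ∀ F₀ ∈ powersetCard 2 {1, 2, 3},
    ∀ F₁ ∈ powersetCard 2 {0, 2, 3}, ¬ Disjoint F₀ F₁ → ∀ F₂ ∈ powersetCard 2 {0, 1, 3},
    ¬ Disjoint F₀ F₂ → ¬ Disjoint F₁ F₂ → ∀ F₃ ∈ powersetCard 2 {0, 1, 2},
    ¬ Disjoint F₀ F₃ → ¬ Disjoint F₁ F₃ → ¬ Disjoint F₂ F₃ → ∃ l : Fin 4, ∀ T : Finset (Fin 4),
      ¬ Disjoint F₀ T → ¬ Disjoint F₁ T → ¬ Disjoint F₂ T → ¬ Disjoint F₃ T → 2 ≤ #(T.erase l) := by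
  decide

/-- The index sets `T v` intersect pairwise and have at least two elements. Either those of size two
share an index `i`, which then gets weight 2, or they contain a triangle, whose missing index `l`
gets weight 0. -/
theorem card_le_of_cover_four {B : Fin 4 → Finset V} (hBR : ∀ i, B i ⊆ R)
    (hcov : ∀ u ∈ R, ∀ v ∈ R, u ≠ v → ∃ i, u ∈ B i ∧ v ∈ B i)
    (hR : 1 < #R) (hB : ∀ i, #(B i) < #R) :
    (∃ i, 3 * #R ≤ #(B i) + ∑ j, #(B j)) ∨ ∃ l, 2 * #R + #(B l) ≤ ∑ j, #(B j) := by
  set T : V → Finset (Fin 4) := fun v => {i | v ∈ B i} with hT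
  have h2 {v : V} (hv : v ∈ R) : 2 ≤ #(T v) := two_le_card_filter_of_cover hcov hR hB hv
  by_cases hstar : ∃ i, ∀ v ∈ R, i ∈ T v ∨ 3 ≤ #(T v)
  · obtain ⟨i, hi⟩ := hstar
    left
    refine ⟨i, ?_⟩
    have := mul_card_le_sum_of_cover hBR (fun j => (if j = i then 1 else 0) + 1) 3 fun v hv => by
      rw [sum_add_distrib, sum_ite_eq']
      have h1 := h2 hv
      have h3 := hi v hv
      rw [← card_eq_sum_ones]
      change 3 ≤ (if i ∈ T v then 1 else 0) + #(T v)
      rcases h3 with h3 | h3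
      · rw [if_pos h3]
        omega
      · exact h3.trans (Nat.le_add_left _ _)
    simpa [add_mul, sum_add_distrib] using this
  · right
    push Not at hstar
    choose v hv hvT hvc using hstar
    have hdisj {u w : V} (hu : u ∈ R) (hw : w ∈ R) : ¬ Disjoint (T u) (T w) := by
      rw [not_disjoint_iff]
      by_cases huw : u = w
      · subst huw
        obtain ⟨i, hi⟩ := card_pos.1 (lt_of_lt_of_le two_pos (h2 hu))
        exact ⟨i, hi, hi⟩
      · obtain ⟨i, hi, hi'⟩ := hcov u hu w hw huw
        exact ⟨i, by simpa [hT], by simpa [hT]⟩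
    have hmem (i : Fin 4) : T (v i) ∈ powersetCard 2 (univ.erase i) := by
      rw [mem_powersetCard, subset_erase]
      have := h2 (hv i)
      have := hvc i
      exact ⟨⟨subset_univ _, hvT i⟩, by omega⟩
    obtain ⟨l, hl⟩ := exists_two_le_card_erase _ (hmem 0) _ (hmem 1) (hdisj (hv 0) (hv 1)) _
      (hmem 2) (hdisj (hv 0) (hv 2)) (hdisj (hv 1) (hv 2)) _ (hmem 3)
      (hdisj (hv 0) (hv 3)) (hdisj (hv 1) (hv 3)) (hdisj (hv 2) (hv 3))
    refine ⟨l, ?_⟩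
    have := mul_card_le_sum_of_cover hBR (fun j => if j ≠ l then 1 else 0) 2 fun w hw => by
      rw [← sum_filter, ← card_eq_sum_ones, filter_ne']
      exact hl (T w) (hdisj (hv 0) hw) (hdisj (hv 1) hw) (hdisj (hv 2) hw)
        (hdisj (hv 3) hw)
    rw [← add_sum_erase univ _ (mem_univ l)]
    rw [← add_sum_erase univ _ (mem_univ l)] at this
    have heq : ∑ j ∈ univ.erase l, (if j ≠ l then 1 else 0) * #(B j) =
        ∑ j ∈ univ.erase l, #(B j) :=
      sum_congr rfl fun j hj => by simp [(mem_erase.1 hj).1]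
    rw [heq] at this
    simp at this
    omega

end Upper

/-! ### Arithmetic and the exceptional cases. -/

section Values

theorem forces_two {p₁ p₂ n : ℕ} (h₁ : p₂ ≤ p₁) (h₂ : 2 ≤ p₂) (hn : p₁ + (p₂ + 2) / 3 - 1 ≤ n) :
    Forces ![p₁, p₂] n := by
  by_contra h
  obtain ⟨R, B, s, hc, hR, hBR, hcov⟩ := exists_cover_of_not_forces h
  have hs := two_mul_card_le_of_cover hBR hcov
  simp [Fin.forall_fin_succ, Fin.sum_univ_succ] at hc hR hs
  omega

theorem forces_three {p₁ p₂ p₃ n : ℕ} (h₁ : p₂ ≤ p₁) (h₂ : p₃ ≤ p₂) (h₃ : 2 ≤ p₃)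
    (hn : p₁ + (p₂ + 2) / 3 + (p₃ + 2) / 3 - 2 ≤ n)
    (hex : p₁ = 3 → p₂ = 3 → p₃ = 3 → 4 ≤ n) : Forces ![p₁, p₂, p₃] n := by
  by_contra h
  obtain ⟨R, B, s, hc, hR, hBR, hcov⟩ := exists_cover_of_not_forces h
  have hs := two_mul_card_le_of_cover hBR hcov
  simp [Fin.forall_fin_succ, Fin.sum_univ_succ] at hc hR hs
  omega

theorem forces_four {p₁ p₂ p₃ p₄ n : ℕ} (h₁ : p₂ ≤ p₁) (h₂ : p₃ ≤ p₂) (h₃ : p₄ ≤ p₃)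
    (h₄ : 2 ≤ p₄) (hn : p₁ + (p₂ + 2) / 3 + (p₃ + 2) / 3 + (p₄ + 2) / 3 - 3 ≤ n)
    (hex : p₁ = 3 → p₂ = 3 → p₃ = 3 → 4 ≤ n)
    (hex' : p₁ = 4 → p₂ = 3 → p₃ = 3 → p₄ = 3 → 5 ≤ n) : Forces ![p₁, p₂, p₃, p₄] n := by
  by_contra h
  obtain ⟨R, B, s, hc, hR, hBR, hcov⟩ := exists_cover_of_not_forces h
  have hs := card_le_of_cover_four hBR hcov
  by_cases hB : 1 < #R ∧ ∀ i, #(B i) < #R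
  · replace hs := hs hB.1 hB.2
    have hs0 : #(B 0) + 3 * s 0 < p₁ := hc 0
    have hs1 : #(B 1) + 3 * s 1 < p₂ := hc 1
    have hs2 : #(B 2) + 3 * s 2 < p₃ := hc 2
    have hs3 : #(B 3) + 3 * s 3 < p₄ := hc 3
    simp only [Fin.sum_univ_four] at hR hs
    clear hB hcov hBR h hc
    rcases hs with ⟨i, hi⟩ | ⟨l, hl⟩
    · have hBi : #(B i) < p₁ := by
        fin_cases i <;> simp only [Fin.zero_eta, Fin.mk_one, Fin.reduceFinMk] <;> omega
      -- With `hn` this forces `p₁ ≤ 4`; the surviving triples and quadruples are those in `hex` and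
      -- `hex'`.
      have : 3 * n + 5 ≤ 2 * p₁ + p₂ + p₃ + p₄ := by omega
      clear hs0 hs1 hs2 hs3 hR hi hBi
      omega
    · have : 2 * n + 3 ≤ p₂ + p₃ + p₄ + 2 * s 0 ∧ 3 * s 0 < p₁ ∨
          2 * n + 3 ≤ p₁ + p₃ + p₄ + 2 * s 1 ∧ 3 * s 1 < p₂ ∨
          2 * n + 3 ≤ p₁ + p₂ + p₄ + 2 * s 2 ∧ 3 * s 2 < p₃ ∨
          2 * n + 3 ≤ p₁ + p₂ + p₃ + 2 * s 3 ∧ 3 * s 3 < p₄ := by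
        fin_cases l <;> simp only [Fin.zero_eta, Fin.mk_one, Fin.reduceFinMk] at hl
        · left; omega
        · right; left; omega
        · right; right; left; omega
        · right; right; right; omega
      clear hs0 hs1 hs2 hs3 hR hl
      have hc1 : p₂ ≤ 3 * ((p₂ + 2) / 3) ∧ 3 * ((p₂ + 2) / 3) ≤ p₂ + 2 := by omega
      have hc2 : p₃ ≤ 3 * ((p₃ + 2) / 3) ∧ 3 * ((p₃ + 2) / 3) ≤ p₃ + 2 := by omega
      have hc3 : p₄ ≤ 3 * ((p₄ + 2) / 3) ∧ 3 * ((p₄ + 2) / 3) ≤ p₄ + 2 := by omega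
      generalize (p₂ + 2) / 3 = c₂ at *
      generalize (p₃ + 2) / 3 = c₃ at *
      generalize (p₄ + 2) / 3 = c₄ at *
      have h1 : 2 ≤ p₁ := by omega
      have hn' : p₁ + c₂ + c₃ + c₄ ≤ n + 3 := by omega
      clear hn
      rcases this with h | h | h | h
      · have : p₁ ≤ 7 := by omega
        interval_cases p₁ <;> omega
      · have : s 1 + 1 ≤ c₂ := by omega
        have : p₁ + 2 * c₃ + 2 * c₄ ≤ p₃ + p₄ + 1 := by omega
        have : p₁ ≤ 3 := by omega
        interval_cases p₁ <;> omega
      · have : s 2 + 1 ≤ c₃ := by omega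
        have : p₁ + 2 * c₂ + 2 * c₄ ≤ p₂ + p₄ + 1 := by omega
        have : p₁ ≤ 3 := by omega
        interval_cases p₁ <;> omega
      · have : s 3 + 1 ≤ c₄ := by omega
        have : p₁ + 2 * c₂ + 2 * c₃ ≤ p₂ + p₃ + 1 := by omega
        have : p₁ ≤ 3 := by omega
        interval_cases p₁ <;> omega
  · have hs0 : #(B 0) + 3 * s 0 < p₁ := hc 0
    have hs1 : #(B 1) + 3 * s 1 < p₂ := hc 1
    have hs2 : #(B 2) + 3 * s 2 < p₃ := hc 2
    have hs3 : #(B 3) + 3 * s 3 < p₄ := hc 3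
    simp only [Fin.sum_univ_four] at hR
    clear hs hcov hBR h hc hex hex'
    -- Since `p - ⌈p / 3⌉` is monotone in `p`, the worst case is that the first colour is the one
    -- filling `R`.
    have h12 : p₂ + (p₁ + 2) / 3 ≤ p₁ + (p₂ + 2) / 3 := by omega
    have h23 : p₃ + (p₂ + 2) / 3 ≤ p₂ + (p₃ + 2) / 3 := by omega
    have h34 : p₄ + (p₃ + 2) / 3 ≤ p₃ + (p₄ + 2) / 3 := by omega
    have hc0 : s 0 + 1 ≤ (p₁ + 2) / 3 := by omega
    have hc1 : s 1 + 1 ≤ (p₂ + 2) / 3 := by omega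
    have hc2 : s 2 + 1 ≤ (p₃ + 2) / 3 := by omega
    have hc3 : s 3 + 1 ≤ (p₄ + 2) / 3 := by omega
    have hp1 : (p₁ + 2) / 3 + 1 ≤ p₁ := by omega
    generalize (p₁ + 2) / 3 = c₁ at *
    generalize (p₂ + 2) / 3 = c₂ at *
    generalize (p₃ + 2) / 3 = c₃ at *
    generalize (p₄ + 2) / 3 = c₄ at *
    by_cases hR1 : 1 < #R
    · have : ∃ i, #R ≤ #(B i) := by
        by_contra! hcon
        exact hB ⟨hR1, hcon⟩
      obtain ⟨i, hi⟩ := this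
      fin_cases i <;> simp only [Fin.zero_eta, Fin.mk_one, Fin.reduceFinMk] at hi <;> omega
    · clear hB
      omega

theorem isRPM_of_forces {r N : ℕ} {p : Fin r → ℕ} (h : Forces p N)
    (h' : ∀ n < N, ¬ Forces p n) : IsRPM p N :=
  ⟨h, fun n hn => not_lt.1 fun hlt => h' n hlt hn⟩

theorem isRPM_two {p₁ p₂ : ℕ} (h₁ : p₂ ≤ p₁) (h₂ : 2 ≤ p₂) :
    IsRPM ![p₁, p₂] (p₁ + (p₂ + 2) / 3 - 1) := by
  refine isRPM_of_forces (forces_two h₁ h₂ le_rfl) fun n hn => not_forces_of_le ?_ ?_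
  · simp [Fin.forall_fin_succ]; omega
  · simp; omega

theorem isRPM_three {p₁ p₂ p₃ : ℕ} (h₁ : p₂ ≤ p₁) (h₂ : p₃ ≤ p₂) (h₃ : 2 ≤ p₃)
    (hex : (p₁, p₂, p₃) ≠ (3, 3, 3)) :
    IsRPM ![p₁, p₂, p₃] (p₁ + (p₂ + 2) / 3 + (p₃ + 2) / 3 - 2) := by
  simp only [ne_eq, Prod.mk.injEq] at hex
  refine isRPM_of_forces (forces_three h₁ h₂ h₃ le_rfl (by omega)) fun n hn =>
    not_forces_of_le ?_ ?_
  · simp [Fin.forall_fin_succ]; omega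
  · simp [Fin.sum_univ_succ]; omega

theorem isRPM_four {p₁ p₂ p₃ p₄ : ℕ} (h₁ : p₂ ≤ p₁) (h₂ : p₃ ≤ p₂) (h₃ : p₄ ≤ p₃) (h₄ : 2 ≤ p₄)
    (hex : (p₁, p₂, p₃, p₄) ≠ (3, 3, 3, 2)) (hex' : (p₁, p₂, p₃, p₄) ≠ (3, 3, 3, 3))
    (hex'' : (p₁, p₂, p₃, p₄) ≠ (4, 3, 3, 3)) :
    IsRPM ![p₁, p₂, p₃, p₄]
      (p₁ + (p₂ + 2) / 3 + (p₃ + 2) / 3 + (p₄ + 2) / 3 - 3) := by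
  simp only [ne_eq, Prod.mk.injEq] at hex hex' hex''
  refine isRPM_of_forces (forces_four h₁ h₂ h₃ h₄ le_rfl (by omega) (by omega)) fun n hn =>
    not_forces_of_le ?_ ?_
  · simp [Fin.forall_fin_succ]; omega
  · simp [Fin.sum_univ_succ]; omega

/-- The edge `{u, v}` of the triangle on `{0, 1, 2}` gets the colour `u + v - 1`. -/
theorem not_forces_three_three_three {n : ℕ} (hn : n < 4) : ¬ Forces ![3, 3, 3] n := by
  interval_cases n <;>
  exact not_forces_of_isEdgeCover (fun u v => Fin.ofNat 3 (u + v - 1)) (by decide)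
    -- The edge of colour `i` is opposite the vertex `2 - i`.
    (fun i => univ.filter fun v => v.1 + i.1 ≠ 2) (fun _ => ∅) (by decide) (by decide)

/-- The same rainbow triangle, with the fourth colour on no edge. -/
theorem not_forces_three_three_three_add {n k : ℕ} (hn : n < 4) (hk : 1 ≤ k) :
    ¬ Forces ![3, 3, 3, k] n := by
  interval_cases n <;>
  exact not_forces_of_isEdgeCover (fun u v => Fin.ofNat 4 (u + v - 1)) (by decide)
    (fun i => univ.filter fun v => i ≠ 3 ∧ v.1 + i.1 ≠ 2) (fun _ => ∅) (by decide)
    (by simp [Fin.forall_fin_succ]; first | omega | exact ⟨by decide, by decide, by decide, by omega⟩)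

/-- The edges of the triangle on `{0, 1, 2}` get the colour `0`, the other three edges of the
complete graph on `{0, 1, 2, 3}` get different colours. -/
theorem not_forces_four_three_three_three {n : ℕ} (hn : n < 5) : ¬ Forces ![4, 3, 3, 3] n := by
  interval_cases n <;>
  exact not_forces_of_isEdgeCover
    (fun u v => if u.1 = 3 ∨ v.1 = 3 then Fin.ofNat 4 (u + v - 2) else 0) (by decide)
    (fun i => univ.filter fun v => if i = 0 then v.1 ≠ 3 else v.1 = 3 ∨ v.1 + 1 = i.1)
    (fun _ => ∅) (by decide) (by decide)

theorem natCeil_div_three (p : ℕ) : ⌈(p : ℚ) / 3⌉₊ = (p + 2) / 3 := by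
  apply eq_of_forall_ge_iff
  intro n
  rw [Nat.ceil_le, div_le_iff₀ three_pos]
  norm_cast
  omega

end Values

end PathMatchingRamsey

/-- In the three formulas the subtraction on `ℕ` never truncates, since `2 ≤ p₁` and every
ceiling is at least `1`. -/
theorem corollary3p7 :
    (∀ p₁ p₂ : ℕ, p₁ ≥ p₂ → p₂ ≥ 2 →
      PathMatchingRamsey.IsRPM ![p₁, p₂] (p₁ + ⌈(p₂ : ℚ) / 3⌉₊ - 1)) ∧
    ((∀ p₁ p₂ p₃ : ℕ, p₁ ≥ p₂ → p₂ ≥ p₃ → p₃ ≥ 2 →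
        (p₁, p₂, p₃) ≠ (3, 3, 3) →
        PathMatchingRamsey.IsRPM ![p₁, p₂, p₃]
          (p₁ + ⌈(p₂ : ℚ) / 3⌉₊ + ⌈(p₃ : ℚ) / 3⌉₊ - 2)) ∧
      PathMatchingRamsey.IsRPM ![3, 3, 3] 4) ∧
    ((∀ p₁ p₂ p₃ p₄ : ℕ, p₁ ≥ p₂ → p₂ ≥ p₃ → p₃ ≥ p₄ → p₄ ≥ 2 →
        (p₁, p₂, p₃, p₄) ≠ (3, 3, 3, 2) →
        (p₁, p₂, p₃, p₄) ≠ (3, 3, 3, 3) →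
        (p₁, p₂, p₃, p₄) ≠ (4, 3, 3, 3) →
        PathMatchingRamsey.IsRPM ![p₁, p₂, p₃, p₄]
          (p₁ + ⌈(p₂ : ℚ) / 3⌉₊ + ⌈(p₃ : ℚ) / 3⌉₊ + ⌈(p₄ : ℚ) / 3⌉₊ - 3)) ∧
      PathMatchingRamsey.IsRPM ![3, 3, 3, 2] 4 ∧
      PathMatchingRamsey.IsRPM ![3, 3, 3, 3] 4 ∧
      PathMatchingRamsey.IsRPM ![4, 3, 3, 3] 5) := by
  simp only [PathMatchingRamsey.natCeil_div_three]
  refine ⟨fun _ _ h₁ h₂ => PathMatchingRamsey.isRPM_two h₁ h₂,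
    ⟨fun _ _ _ h₁ h₂ h₃ hex => PathMatchingRamsey.isRPM_three h₁ h₂ h₃ hex, ?_⟩,
    fun _ _ _ _ h₁ h₂ h₃ h₄ hex hex' hex'' =>
      PathMatchingRamsey.isRPM_four h₁ h₂ h₃ h₄ hex hex' hex'', ?_, ?_, ?_⟩
  · exact PathMatchingRamsey.isRPM_of_forces
      (PathMatchingRamsey.forces_three (by simp) (by simp) (by simp) (by simp) (by simp))
      fun n hn => PathMatchingRamsey.not_forces_three_three_three hn
  · exact PathMatchingRamsey.isRPM_of_forces
      (PathMatchingRamsey.forces_four (by simp) (by simp) (by simp) (by simp) (by simp) (by simp)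
        (by simp))
      fun n hn => PathMatchingRamsey.not_forces_three_three_three_add hn (by simp)
  · exact PathMatchingRamsey.isRPM_of_forces
      (PathMatchingRamsey.forces_four (by simp) (by simp) (by simp) (by simp) (by simp) (by simp)
        (by simp))
      fun n hn => PathMatchingRamsey.not_forces_three_three_three_add hn (by simp)
  · exact PathMatchingRamsey.isRPM_of_forces
      (PathMatchingRamsey.forces_four (by simp) (by simp) (by simp) (by simp) (by simp) (by simp)
        (by simp))
      fun n hn => PathMatchingRamsey.not_forces_four_three_three_three hn
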